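/- Let $n,m\in\mathbb{N}$, $A\in\mathbb{R}^{n\times n}$, $B\in\mathbb{R}^{n\times m}$ and $\mathcal{C}\subset\mathbb{R}^{n+m}$. Definitions. A $C$-set is a compact convex set containing the origin; a proper $C$-set is a $C$-set containing the origin in its interior. The polar set of $\mathcal{X}$ is $\mathcal{X}^*=\{x : y^Tx\le 1 \text{ for all } y\in\mathcal{X}\}$, $\oplus$ is Minkowski addition, and $P_x:\mathbb{R}^{n+m}\to\mathbb{R}^n$ is the projection $(x,u)\mapsto x$. The pair $(A,B)$ is strictly stabilizable if the uncontrollable part of the system $x^+=Ax+Bu$, that is, the linear map induced by $A$ on the quotient of $\mathbb{R}^n$ by the controllable subspace $\sum_{k\ge 0}\operatorname{range}(A^kB)$, is strictly stable (all its complex eigenvalues $\lambda$ satisfy $|\lambda|<1$). Given an initial set $\mathcal{P}_0\subseteq\mathbb{R}^n$, define $\mathcal{P}_1,\mathcal{P}_2,\ldots$ by $$\mathcal{P}_{k+1}=P_x\left(\mathcal{C}^*\oplus (A\ B)^T\mathcal{P}_k^*\right)^*,\qquad k\in\mathbb{N}.$$ Theorem. Suppose that $(A,B)$ is strictly stabilizable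 and that $\mathcal{C}$ is a proper $C$-set in $\mathbb{R}^{n+m}$. Let $\mathcal{P}_0',\mathcal{P}_0''\subseteq\mathbb{R}^n$ be such that $(\mathcal{P}_0')^*$ and $(\mathcal{P}_0'')^*$ are $C$-sets in $\mathbb{R}^n$, and let $\mathcal{P}_k'$ and $\mathcal{P}_k''$ be the corresponding iterates. Suppose that (I) $(\mathcal{P}_0'')^*\subseteq(\mathcal{P}_0')^*$; (II) $(\mathcal{P}_0')^*\subseteq(\mathcal{P}_1')^*$ or $(\mathcal{P}_1')^*\subseteq(\mathcal{P}_0')^*$; (III) $(\mathcal{P}_0'')^*\subseteq(\mathcal{P}_1'')^*$ or $(\mathcal{P}_1'')^*\subseteq(\mathcal{P}_0'')^*$. Then the sequences $\{\mathcal{P}_k'\}_{k\ge 1}$ and $\{\mathcal{P}_k''\}_{k\ge 1}$ converge, with respect to the Hausdorff distance, to proper $C$-sets $\mathcal{P}_\infty'$ and $\mathcal{P}_\infty''$ in $\mathbb{R}^n$, and these limits satisfy $$\mathcal{P}_\infty'\subseteq\mathcal{P}_\infty''.$$ -/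

import Mathlib

open scoped Pointwise

noncomputable section

namespace MinkowskiBellman

/-- The Euclidean space `ℝ^ι`. The state space is `Vec (Fin n)`, and `ℝ^{n+m}`, the space of pairs
`(x, u)`, is `Vec (Fin n ⊕ Fin m)`. -/
abbrev Vec (ι : Type) [Fintype ι] : Type := EuclideanSpace ℝ ι

/-- A `C`-set: compact, convex, and containing the origin. -/
def IsCSet {ι : Type} [Fintype ι] (X : Set (Vec ι)) : Prop :=
  IsCompact X ∧ Convex ℝ X ∧ (0 : Vec ι) ∈ X

/-- A proper `C`-set: a `C`-set containing the origin in its interior. -/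
def IsProperCSet {ι : Type} [Fintype ι] (X : Set (Vec ι)) : Prop :=
  IsCSet X ∧ (0 : Vec ι) ∈ interior X

/-- The (one-sided) polar set `X^* = {x | ∀ y ∈ X, yᵀ x ≤ 1}`. -/
def polarSet {ι : Type} [Fintype ι] (X : Set (Vec ι)) : Set (Vec ι) :=
  {x | ∀ y ∈ X, inner ℝ y x ≤ 1}

/-- The image `M X = {M x | x ∈ X}` of a set under a matrix. -/
def matImage {ι κ : Type} [Fintype ι] [Fintype κ] [DecidableEq ι]
    (M : Matrix κ ι ℝ) (X : Set (Vec ι)) : Set (Vec κ) :=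
  Matrix.toEuclideanLin M '' X

/-- The projection matrix `P_x = (I O)`, that is `(x, u) ↦ x`. -/
def projX (n m : ℕ) : Matrix (Fin n) (Fin n ⊕ Fin m) ℝ :=
  Matrix.fromCols 1 0

/-- The reachable (controllable) subspace of `x⁺ = A x + B u`: the span of the ranges of
`B, A B, A² B, …`. -/
def controllableSubspace {n m : ℕ} (A : Matrix (Fin n) (Fin n) ℝ) (B : Matrix (Fin n) (Fin m) ℝ) :
    Submodule ℝ (Vec (Fin n)) :=
  ⨆ k : ℕ, LinearMap.range (Matrix.toEuclideanLin (A ^ k * B))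

theorem controllableSubspace_le_comap {n m : ℕ}
    (A : Matrix (Fin n) (Fin n) ℝ) (B : Matrix (Fin n) (Fin m) ℝ) :
    controllableSubspace A B ≤
      (controllableSubspace A B).comap (Matrix.toEuclideanLin A) := by
  refine iSup_le fun k => ?_
  rintro _ ⟨u, rfl⟩
  refine Submodule.mem_iSup_of_mem (k + 1) ⟨u, ?_⟩
  simp [Matrix.toLpLin_apply, pow_succ', Matrix.mul_assoc]

/-- The uncontrollable part of `x⁺ = A x + B u`: the dynamics induced by `A` on the quotient of the
state space by the controllable subspace. -/
def uncontrollablePart {n m : ℕ} (A : Matrix (Fin n) (Fin n) ℝ) (B : Matrix (Fin n) (Fin m) ℝ) :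
    Module.End ℝ (Vec (Fin n) ⧸ controllableSubspace A B) :=
  (controllableSubspace A B).mapQ (controllableSubspace A B) (Matrix.toEuclideanLin A)
    (controllableSubspace_le_comap A B)

/-- Strict stability of a real linear discrete time system `z⁺ = f z`: all complex eigenvalues (the
complex roots of the characteristic polynomial) lie in the open unit disc. -/
def IsStrictlyStable {V : Type} [AddCommGroup V] [Module ℝ V] [Module.Finite ℝ V]
    (f : Module.End ℝ V) : Prop :=
  ∀ z : ℂ, Polynomial.aeval z (LinearMap.charpoly f) = 0 → ‖z‖ < 1

/-- `(A, B)` is strictly stabilizable: the dynamics of the uncontrollable part is strictly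
stable. -/
def IsStrictlyStabilizable {n m : ℕ} (A : Matrix (Fin n) (Fin n) ℝ)
    (B : Matrix (Fin n) (Fin m) ℝ) : Prop :=
  IsStrictlyStable (uncontrollablePart A B)

/-- One step of the set-dynamics: `P⁺ = P_x (C^* ⊕ (A B)ᵀ P^*)^*`. -/
def setStep {n m : ℕ} (A : Matrix (Fin n) (Fin n) ℝ) (B : Matrix (Fin n) (Fin m) ℝ)
    (C : Set (Vec (Fin n ⊕ Fin m))) (P : Set (Vec (Fin n))) : Set (Vec (Fin n)) :=
  matImage (projX n m)
    (polarSet (polarSet C + matImage (Matrix.fromCols A B).transpose (polarSet P)))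

/-- The iterates `P_0, P_1, P_2, …` of the set-dynamics from the initial set `P₀`. -/
def generatorSet {n m : ℕ} (A : Matrix (Fin n) (Fin n) ℝ) (B : Matrix (Fin n) (Fin m) ℝ)
    (C : Set (Vec (Fin n ⊕ Fin m))) (P₀ : Set (Vec (Fin n))) : ℕ → Set (Vec (Fin n))
  | 0 => P₀
  | k + 1 => setStep A B C (generatorSet A B C P₀ k)

/-- The sequence of sets `X k` converges, in the Hausdorff distance of the Euclidean norm, to the
nonempty compact set `L`. -/
def HausdorffConverges {ι : Type} [Fintype ι] (X : ℕ → Set (Vec ι)) (L : Set (Vec ι)) : Prop :=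
  L.Nonempty ∧ IsCompact L ∧
    Filter.Tendsto (fun k => Metric.hausdorffEDist (X k) L) Filter.atTop (nhds 0)

end MinkowskiBellman

end

noncomputable section

namespace MinkowskiBellman

open Filter Topology

/-! The step sees a set only through its polar and reverses inclusions of polars, so (II) and (III)
make the iterates monotone from index 1 on, and (I) orders the two sequences. Increasing iterates
stay in the compact set `P_x C` and converge to the closure of their union. Decreasing ones converge
to their intersection; the difficulty is that it might have empty interior, and this is excluded by
bounding the polars uniformly.

By the bipolar theorem, `q ∈ P_{k+1}^*` means `q = Aᵀp + c`, `0 = Bᵀp + d` with `p ∈ P_k^*` and `(c,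
d) ∈ C^*` (`exists_of_mem_polarSet_setStep`). Iterating gives trajectories with bounded
disturbances. All `Bᵀ(Aᵀ)ʲ p_N` with `j < N` are bounded, which controls the component of `p_N` in
the controllable subspace; on its orthogonal complement stabilizability makes `(Aᵀ)ᴺ` a contraction.
Hence `‖p_0‖ ≤ K + ‖p_N‖/2` for some `N`, and applying this to an element of largest norm gives the
bound `2K`. -/

/-! ### Powers of strictly stable maps -/

/-- Gelfand's formula: eventually `‖a ^ k‖ ≤ r ^ k` for any `r` strictly between the spectral radius
and 1. -/
theorem tendsto_pow_zero_of_spectralRadius_lt_one {R : Type*} [NormedRing R] [NormedAlgebra ℂ R]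
    [CompleteSpace R] {a : R} (ha : spectralRadius ℂ a < 1) :
    Tendsto (fun k : ℕ => a ^ k) atTop (𝓝 0) := by
  obtain ⟨r, hr, hr1⟩ := ENNReal.lt_iff_exists_nnreal_btwn.1 ha
  have hr1' : r < 1 := by exact_mod_cast hr1
  have h := (spectrum.pow_nnnorm_pow_one_div_tendsto_nhds_spectralRadius a).eventually_lt_const hr
  refine squeeze_zero_norm' (a := fun k : ℕ => (r : ℝ) ^ k) ?_
    (tendsto_pow_atTop_nhds_zero_of_lt_one r.coe_nonneg (by exact_mod_cast hr1'))
  filter_upwards [h, eventually_gt_atTop 0] with k hk hk0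
  have h2 := ENNReal.rpow_le_rpow hk.le (Nat.cast_nonneg (α := ℝ) k)
  rw [← ENNReal.rpow_mul, one_div, inv_mul_cancel₀ (by positivity), ENNReal.rpow_one,
    ENNReal.rpow_natCast] at h2
  exact_mod_cast h2

section
attribute [local instance] Matrix.linftyOpNormedRing Matrix.linftyOpNormedAlgebra

theorem tendsto_matrix_pow_zero {ι : Type*} [Fintype ι] [DecidableEq ι] (M : Matrix ι ι ℂ)
    (hM : ∀ z : ℂ, M.charpoly.IsRoot z → ‖z‖ < 1) :
    Tendsto (fun k : ℕ => M ^ k) atTop (𝓝 0) := by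
  cases isEmpty_or_nonempty ι
  · exact tendsto_const_nhds.congr fun k => Subsingleton.elim _ _
  · refine tendsto_pow_zero_of_spectralRadius_lt_one ?_
    refine spectrum.spectralRadius_lt_of_forall_lt M (r := 1) fun z hz => ?_
    exact_mod_cast hM z (Matrix.mem_spectrum_iff_isRoot_charpoly.1 hz)

end

theorem tendsto_real_matrix_pow_zero {ι : Type*} [Fintype ι] [DecidableEq ι] (M : Matrix ι ι ℝ)
    (hM : ∀ z : ℂ, Polynomial.aeval z M.charpoly = 0 → ‖z‖ < 1) :
    Tendsto (fun k : ℕ => M ^ k) atTop (𝓝 0) := by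
  have h := tendsto_matrix_pow_zero (M.map (algebraMap ℝ ℂ)) fun z hz => hM z <| by
    rw [Matrix.charpoly_map, Polynomial.IsRoot, Polynomial.eval_map_algebraMap] at hz
    exact hz
  have h2 : Tendsto (fun k : ℕ => (((M.map (algebraMap ℝ ℂ)) ^ k).map Complex.re)) atTop
      (𝓝 ((0 : Matrix ι ι ℂ).map Complex.re)) :=
    ((continuous_id.matrix_map Complex.continuous_re).tendsto _).comp h
  convert h2 using 1
  · ext k i j
    rw [← Matrix.map_pow]
    simp
  · rw [Matrix.map_zero _ Complex.zero_re]

/-- The powers of a strictly stable map tend to zero, in the sense that so do their images under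
any linear map to a finite-dimensional normed space. -/
theorem IsStrictlyStable.tendsto_pow {V : Type} [AddCommGroup V] [Module ℝ V] [Module.Finite ℝ V]
    {f : Module.End ℝ V} (hf : IsStrictlyStable f) {G : Type*} [NormedAddCommGroup G]
    [NormedSpace ℝ G] (Φ : Module.End ℝ V →ₗ[ℝ] G) :
    Tendsto (fun k : ℕ => Φ (f ^ k)) atTop (𝓝 0) := by
  let b := Module.finBasis ℝ V
  let e := LinearMap.toMatrixAlgEquiv b
  have h := tendsto_real_matrix_pow_zero (e f) fun z hz => hf z <| by
    rwa [← LinearMap.charpoly_toMatrix f b]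
  let Ψ : Matrix (Fin (Module.finrank ℝ V)) (Fin (Module.finrank ℝ V)) ℝ →ₗ[ℝ] G :=
    Φ ∘ₗ e.symm.toLinearMap
  have hΨ : Continuous Ψ := LinearMap.continuous_of_finiteDimensional Ψ
  have h2 := (hΨ.tendsto 0).comp h
  rw [map_zero] at h2
  refine h2.congr fun k => ?_
  simp [Ψ]

section Trajectories

/-! ### Backward trajectories of the dual system -/

variable {E F : Type*} [NormedAddCommGroup E] [InnerProductSpace ℝ E]
  [NormedAddCommGroup F] [InnerProductSpace ℝ F]

/-- A finite backward trajectory of `y = f y⁺ + c`, `0 = g y⁺ + d` with disturbances `c`, `d` of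
norm at most `r`. -/
def IsBackwardTrajectory (f : E →ₗ[ℝ] E) (g : E →ₗ[ℝ] F) (r : ℝ) (N : ℕ) (p : ℕ → E) : Prop :=
  ∀ i < N, ‖p i - f (p (i + 1))‖ ≤ r ∧ ‖g (p (i + 1))‖ ≤ r

theorem IsBackwardTrajectory.shift {f : E →ₗ[ℝ] E} {g : E →ₗ[ℝ] F} {r : ℝ} {N : ℕ} {p : ℕ → E}
    (s : ℕ) (h : IsBackwardTrajectory f g r (s + N) p) :
    IsBackwardTrajectory f g r N (fun i => p (s + i)) :=
  fun i hi => h (s + i) (by omega)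

variable [FiniteDimensional ℝ E]

theorem exists_norm_le (f : E →ₗ[ℝ] F) : ∃ K, 0 ≤ K ∧ ∀ x, ‖f x‖ ≤ K * ‖x‖ :=
  ⟨‖f.toContinuousLinearMap‖, norm_nonneg _, fun x => f.toContinuousLinearMap.le_opNorm x⟩

/-- The difference telescopes into `∑ fⁱ (p i - f (p (i + 1)))`, a sum of `N` bounded terms. -/
theorem IsBackwardTrajectory.exists_sub_le (f : E →ₗ[ℝ] E) (g : E →ₗ[ℝ] F) (r : ℝ) (N : ℕ) :
    ∃ K, ∀ p, IsBackwardTrajectory f g r N p → ‖p 0 - (f ^ N) (p N)‖ ≤ K := by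
  induction N with
  | zero => exact ⟨0, fun p _ => by simp⟩
  | succ N ih =>
    obtain ⟨K, hK⟩ := ih
    obtain ⟨a, ha0, ha⟩ := exists_norm_le f
    refine ⟨r + a * K, fun p hp => ?_⟩
    have h1 := hK _ (IsBackwardTrajectory.shift 1 (add_comm N 1 ▸ hp))
    have h0 := (hp 0 (by omega)).1
    have heq : p 0 - (f ^ (N + 1)) (p (N + 1)) =
        (p 0 - f (p (0 + 1))) + f (p (1 + 0) - (f ^ N) (p (1 + N))) := by
      rw [pow_succ', Module.End.mul_apply, map_sub, add_comm 1 N]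
      simp
    rw [heq]
    exact (norm_add_le _ _).trans (add_le_add h0 ((ha _).trans
      (mul_le_mul_of_nonneg_left h1 ha0)))

/-- `f ^ j (p N)` is within a bounded distance of `p (N - j)`, whose output is at most `r`. Only the
last `j` steps matter, so `K` does not depend on `N`. -/
theorem IsBackwardTrajectory.exists_observation_le (f : E →ₗ[ℝ] E) (g : E →ₗ[ℝ] F) (r : ℝ)
    (j : ℕ) : ∃ K, ∀ N p, j < N → IsBackwardTrajectory f g r N p → ‖g ((f ^ j) (p N))‖ ≤ K := by
  obtain ⟨K, hK⟩ := exists_sub_le f g r j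
  obtain ⟨a, ha0, ha⟩ := exists_norm_le g
  refine ⟨r + a * K, fun N p hj hp => ?_⟩
  obtain ⟨s, rfl⟩ := Nat.exists_eq_add_of_lt hj
  have h1 := hK _ (IsBackwardTrajectory.shift (s + 1) (N := j)
    (by convert hp using 1; omega))
  have h0 := (hp s (by omega)).2
  have heq : g ((f ^ j) (p (j + s + 1))) =
      g (p (s + 1)) - g (p (s + 1 + 0) - (f ^ j) (p (s + 1 + j))) := by
    rw [map_sub, show s + 1 + j = j + s + 1 by omega]
    simp
  rw [heq]
  exact (norm_sub_le _ _).trans (add_le_add h0 ((ha _).trans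
    (mul_le_mul_of_nonneg_left h1 ha0)))

variable [FiniteDimensional ℝ F]

/-- Along backward trajectories that are long enough, the final state has a bounded component in
every direction observed by the outputs `g ∘ f ^ j`. -/
theorem IsBackwardTrajectory.exists_inner_le (f : E →ₗ[ℝ] E) (g : E →ₗ[ℝ] F) (r : ℝ)
    (R : Submodule ℝ E)
    (hR : R = ⨆ j : ℕ, LinearMap.range ((g ∘ₗ f ^ j).adjoint)) {x : E} (hx : x ∈ R) :
    ∃ K N₀, ∀ N p, N₀ ≤ N → IsBackwardTrajectory f g r N p → |inner ℝ x (p N)| ≤ K := by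
  rw [hR] at hx
  induction hx using Submodule.iSup_induction' with
  | mem j x hx =>
    obtain ⟨u, rfl⟩ := hx
    obtain ⟨K, hK⟩ := exists_observation_le f g r j
    refine ⟨‖u‖ * K, j + 1, fun N p hN hp => ?_⟩
    rw [LinearMap.adjoint_inner_left]
    exact (abs_real_inner_le_norm _ _).trans
      (mul_le_mul_of_nonneg_left (hK N p hN hp) (norm_nonneg _))
  | zero => exact ⟨0, 0, by simp⟩
  | add x y _ _ hx hy =>
    obtain ⟨K, N₀, h⟩ := hx
    obtain ⟨K', N₀', h'⟩ := hy
    refine ⟨K + K', max N₀ N₀', fun N p hN hp => ?_⟩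
    rw [inner_add_left]
    exact (abs_add_le _ _).trans (add_le_add (h N p (le_of_max_le_left hN) hp)
      (h' N p (le_of_max_le_right hN) hp))

theorem IsBackwardTrajectory.exists_proj_le (f : E →ₗ[ℝ] E) (g : E →ₗ[ℝ] F) (r : ℝ)
    (R : Submodule ℝ E) (hR : R = ⨆ j : ℕ, LinearMap.range ((g ∘ₗ f ^ j).adjoint)) :
    ∃ K N₀, ∀ N p, N₀ ≤ N → IsBackwardTrajectory f g r N p → ‖R.starProjection (p N)‖ ≤ K := by
  let b := stdOrthonormalBasis ℝ R
  choose K N₀ h using fun i => exists_inner_le f g r R hR (b i).2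
  refine ⟨∑ i, K i, Finset.univ.sup N₀, fun N p hN hp => ?_⟩
  rw [b.starProjection_eq_sum_rankOne]
  simp only [sum_apply, InnerProductSpace.rankOne_apply]
  refine (norm_sum_le _ _).trans (Finset.sum_le_sum fun i _ => ?_)
  have hb : ‖(b i : E)‖ = 1 := b.norm_eq_one i
  rw [norm_smul, hb, mul_one]
  exact h i N p ((Finset.le_sup (Finset.mem_univ i)).trans hN) hp

/-- If the powers of `f` contract the unobservable subspace, then backward trajectories of a
suitable length contract up to a constant. -/
theorem IsBackwardTrajectory.exists_contraction (f : E →ₗ[ℝ] E) (g : E →ₗ[ℝ] F) (r : ℝ)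
    (R : Submodule ℝ E) (hR : R = ⨆ j : ℕ, LinearMap.range ((g ∘ₗ f ^ j).adjoint))
    (hf : ∀ᶠ N : ℕ in atTop, ∀ y ∈ Rᗮ, ‖(f ^ N) y‖ ≤ 1 / 2 * ‖y‖) :
    ∃ K N, ∀ p, IsBackwardTrajectory f g r N p → ‖p 0‖ ≤ K + 1 / 2 * ‖p N‖ := by
  obtain ⟨K, N₀, hK⟩ := exists_proj_le f g r R hR
  obtain ⟨N, hN, hN₀⟩ := (hf.and (eventually_ge_atTop N₀)).exists
  obtain ⟨K', hK'⟩ := exists_sub_le f g r N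
  obtain ⟨a, ha0, ha⟩ := exists_norm_le (f ^ N)
  refine ⟨K' + a * K, N, fun p hp => ?_⟩
  have h1 := hK N p hN₀ hp
  have h2 := hN _ (Rᗮ.starProjection_apply_mem (p N))
  have h3 : ‖Rᗮ.starProjection (p N)‖ ≤ ‖p N‖ := Rᗮ.norm_starProjection_apply_le _
  have hsum : p N = R.starProjection (p N) + Rᗮ.starProjection (p N) :=
    (R.starProjection_add_starProjection_orthogonal (p N)).symm
  have heq : p 0 = (p 0 - (f ^ N) (p N)) + ((f ^ N) (R.starProjection (p N)) +
      (f ^ N) (Rᗮ.starProjection (p N))) := by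
    rw [← map_add, ← hsum, sub_add_cancel]
  have h4 := (ha (R.starProjection (p N))).trans (mul_le_mul_of_nonneg_left h1 ha0)
  have h5 := hK' p hp
  calc ‖p 0‖ ≤ ‖p 0 - (f ^ N) (p N)‖ + (‖(f ^ N) (R.starProjection (p N))‖ +
        ‖(f ^ N) (Rᗮ.starProjection (p N))‖) := by
        conv_lhs => rw [heq]
        exact (norm_add_le _ _).trans (add_le_add le_rfl (norm_add_le _ _))
    _ ≤ K' + a * K + 1 / 2 * ‖p N‖ := by linarith

end Trajectories

/-- If `A` is strictly stable modulo an invariant subspace `R`, the powers of its adjoint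
contract `Rᗮ`. -/
theorem eventually_adjoint_pow_le {E : Type} [NormedAddCommGroup E] [InnerProductSpace ℝ E]
    [FiniteDimensional ℝ E] (A : E →ₗ[ℝ] E) (R : Submodule ℝ E) (hR : R ≤ R.comap A)
    (hA : IsStrictlyStable (R.mapQ R A hR)) :
    ∀ᶠ N : ℕ in atTop, ∀ y ∈ Rᗮ, ‖(A.adjoint ^ N) y‖ ≤ 1 / 2 * ‖y‖ := by
  -- A linear section `s` of the quotient map turns powers on `E ⧸ R` into operators on `E`, where
  -- norms are available.
  obtain ⟨s, hs⟩ := R.mkQ.exists_rightInverse_of_surjective R.range_mkQ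
  let Φ : Module.End ℝ (E ⧸ R) →ₗ[ℝ] (E →L[ℝ] E) :=
    LinearMap.toContinuousLinearMap.toLinearMap ∘ₗ
      (LinearMap.llcomp ℝ E (E ⧸ R) E s) ∘ₗ (LinearMap.lcomp ℝ (E ⧸ R) R.mkQ)
  have hΦ : ∀ T x, Φ T x = s (T (R.mkQ x)) := fun T x => rfl
  have h := (hA.tendsto_pow Φ).norm
  rw [norm_zero] at h
  filter_upwards [h.eventually_le_const (show (0 : ℝ) < 1 / 2 by norm_num)] with N hN y hy
  have hpow : ∀ x, (R.mapQ R A hR ^ N) (R.mkQ x) = R.mkQ ((A ^ N) x) := by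
    intro x
    rw [← Submodule.mapQ_pow]
    rfl
  -- Pairing with `y ∈ Rᗮ` depends only on the class modulo `R`, so `A ^ N x` may be replaced by the
  -- lift of its class.
  have key : ∀ x, inner ℝ ((A.adjoint ^ N) y) x = inner ℝ y (Φ (R.mapQ R A hR ^ N) x) := by
    intro x
    have hpa : A.adjoint ^ N = (A ^ N).adjoint := (star_pow A N).symm
    rw [hpa, LinearMap.adjoint_inner_left, hΦ, hpow, ← sub_eq_zero, ← inner_sub_right]
    refine Submodule.inner_left_of_mem_orthogonal ?_ hy
    rw [← Submodule.Quotient.mk_eq_zero, ← Submodule.mkQ_apply, map_sub, sub_eq_zero]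
    exact (LinearMap.congr_fun hs _).symm
  have h2 := key ((A.adjoint ^ N) y)
  rw [real_inner_self_eq_norm_sq] at h2
  have h3 : ‖(A.adjoint ^ N) y‖ ^ 2 ≤ ‖y‖ * (1 / 2 * ‖(A.adjoint ^ N) y‖) := by
    rw [h2]
    exact (real_inner_le_norm _ _).trans (mul_le_mul_of_nonneg_left
      ((Φ _).le_of_opNorm_le hN _) (norm_nonneg _))
  rcases (norm_nonneg ((A.adjoint ^ N) y)).eq_or_lt with h0 | h0
  · rw [← h0]; positivity
  · nlinarith

/-! ### Polar sets -/

section Polar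
variable {ι κ : Type} [Fintype ι] [Fintype κ]

theorem polarSet_anti {X Y : Set (Vec ι)} (h : X ⊆ Y) : polarSet Y ⊆ polarSet X :=
  fun _ hx y hy => hx y (h hy)

theorem zero_mem_polarSet (X : Set (Vec ι)) : (0 : Vec ι) ∈ polarSet X := by
  simp [polarSet]

theorem isClosed_polarSet (X : Set (Vec ι)) : IsClosed (polarSet X) := by
  have : polarSet X = ⋂ y ∈ X, {x | inner ℝ y x ≤ 1} := by
    ext; simp [polarSet]
  rw [this]
  exact isClosed_biInter fun y _ => isClosed_le (by fun_prop) continuous_const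

theorem convex_polarSet (X : Set (Vec ι)) : Convex ℝ (polarSet X) := by
  intro x hx z hz a b ha hb hab y hy
  rw [inner_add_right, inner_smul_right, inner_smul_right]
  nlinarith [mul_le_mul_of_nonneg_left (hx y hy) ha, mul_le_mul_of_nonneg_left (hz y hy) hb]

theorem subset_polarSet_polarSet (X : Set (Vec ι)) : X ⊆ polarSet (polarSet X) :=
  fun x hx y hy => by rw [real_inner_comm]; exact hy x hx

/-- The bipolar theorem. -/
theorem polarSet_polarSet {X : Set (Vec ι)} (hc : IsClosed X) (hconv : Convex ℝ X)
    (h0 : (0 : Vec ι) ∈ X) : polarSet (polarSet X) = X := by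
  refine Set.Subset.antisymm (fun x hx => ?_) (subset_polarSet_polarSet X)
  by_contra hxX
  obtain ⟨f, u, hf, hu⟩ := geometric_hahn_banach_closed_point hconv hc hxX
  have hu0 : 0 < u := by simpa using hf 0 h0
  let y := (InnerProductSpace.toDual ℝ (Vec ι)).symm f
  have hy : ∀ z, inner ℝ y z = f z := fun z => InnerProductSpace.toDual_symm_apply
  -- The separating functional, rescaled to level 1, lies in the polar but exceeds 1 at `x`.
  have hmem : u⁻¹ • y ∈ polarSet X := by
    intro z hz
    rw [inner_smul_right, real_inner_comm, hy, inv_mul_le_one₀ hu0]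
    exact (hf z hz).le
  have := hx _ hmem
  rw [inner_smul_left, hy] at this
  simp only [conj_trivial] at this
  rw [inv_mul_le_one₀ hu0] at this
  linarith

theorem norm_le_of_mem_polarSet {X : Set (Vec ι)} {ε : ℝ} (hε : 0 < ε)
    (hX : Metric.closedBall 0 ε ⊆ X) {y : Vec ι} (hy : y ∈ polarSet X) : ‖y‖ ≤ ε⁻¹ := by
  rcases (norm_nonneg y).eq_or_lt with h0 | h0
  · rw [← h0]; positivity
  have hm : (ε * ‖y‖⁻¹) • y ∈ X := hX (by
    rw [mem_closedBall_zero_iff, norm_smul, Real.norm_of_nonneg (by positivity), mul_assoc,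
      inv_mul_cancel₀ h0.ne', mul_one])
  have := hy _ hm
  rw [inner_smul_left, real_inner_self_eq_norm_sq] at this
  simp only [conj_trivial] at this
  rw [← one_div, le_div_iff₀ hε]
  calc ‖y‖ * ε = ε * ‖y‖⁻¹ * ‖y‖ ^ 2 := by field_simp
    _ ≤ 1 := this

theorem closedBall_subset_polarSet {X : Set (Vec ι)} {r : ℝ} (hr : 0 < r)
    (hX : ∀ y ∈ X, ‖y‖ ≤ r) : Metric.closedBall 0 r⁻¹ ⊆ polarSet X := by
  intro x hx y hy
  rw [mem_closedBall_zero_iff] at hx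
  calc inner ℝ y x ≤ ‖y‖ * ‖x‖ := real_inner_le_norm _ _
    _ ≤ r * r⁻¹ := mul_le_mul (hX y hy) hx (norm_nonneg _) hr.le
    _ = 1 := mul_inv_cancel₀ hr.ne'

theorem exists_closedBall_subset {X : Set (Vec ι)} (h : (0 : Vec ι) ∈ interior X) :
    ∃ ε > 0, Metric.closedBall 0 ε ⊆ X := by
  simpa using Metric.nhds_basis_closedBall.mem_iff.1 (mem_interior_iff_mem_nhds.1 h)

theorem isCSet_polarSet {X : Set (Vec ι)} (h : (0 : Vec ι) ∈ interior X) :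
    IsCSet (polarSet X) := by
  obtain ⟨ε, hε, hX⟩ := exists_closedBall_subset h
  refine ⟨Metric.isCompact_of_isClosed_isBounded (isClosed_polarSet X) ?_, convex_polarSet X,
    zero_mem_polarSet X⟩
  exact isBounded_iff_forall_norm_le.2 ⟨ε⁻¹, fun y hy => norm_le_of_mem_polarSet hε hX hy⟩

theorem zero_mem_interior_polarSet {X : Set (Vec ι)} (h : IsCompact X) :
    (0 : Vec ι) ∈ interior (polarSet X) := by
  obtain ⟨r, hr, hX⟩ := h.isBounded.exists_pos_norm_le
  exact mem_interior_iff_mem_nhds.2 (mem_of_superset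
    (Metric.closedBall_mem_nhds 0 (inv_pos.2 hr)) (closedBall_subset_polarSet hr hX))

theorem IsCSet.add {X Y : Set (Vec ι)} (hX : IsCSet X) (hY : IsCSet Y) : IsCSet (X + Y) :=
  ⟨hX.1.add hY.1, hX.2.1.add hY.2.1, ⟨0, hX.2.2, 0, hY.2.2, add_zero 0⟩⟩

theorem IsCSet.matImage [DecidableEq ι] {X : Set (Vec ι)} (hX : IsCSet X) (M : Matrix κ ι ℝ) :
    IsCSet (matImage M X) :=
  ⟨hX.1.image (LinearMap.continuous_of_finiteDimensional _), hX.2.1.linear_image _,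
    ⟨0, hX.2.2, map_zero _⟩⟩

theorem toEuclideanLin_transpose [DecidableEq ι] [DecidableEq κ] (M : Matrix κ ι ℝ) :
    Matrix.toEuclideanLin M.transpose = (Matrix.toEuclideanLin M).adjoint := by
  rw [← Matrix.conjTranspose_eq_transpose_of_trivial,
    Matrix.toEuclideanLin_conjTranspose_eq_adjoint]

theorem inner_transpose [DecidableEq ι] [DecidableEq κ] (M : Matrix κ ι ℝ) (x : Vec ι)
    (y : Vec κ) :
    inner ℝ (Matrix.toEuclideanLin M x) y = inner ℝ x (Matrix.toEuclideanLin M.transpose y) := by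
  rw [toEuclideanLin_transpose, LinearMap.adjoint_inner_right]

theorem polarSet_matImage [DecidableEq ι] [DecidableEq κ] (M : Matrix κ ι ℝ) (X : Set (Vec ι)) :
    polarSet (matImage M X) = {y | Matrix.toEuclideanLin M.transpose y ∈ polarSet X} := by
  ext y
  simp [polarSet, MinkowskiBellman.matImage, inner_transpose]

end Polar

/-! ### Monotone sequences of compact sets -/

theorem hausdorffConverges_of_antitone {ι : Type} [Fintype ι] {X : ℕ → Set (Vec ι)}
    (hX : Antitone X) (hc : ∀ k, IsCompact (X k)) (hne : (⋂ k, X k).Nonempty) :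
    HausdorffConverges X (⋂ k, X k) := by
  refine ⟨hne, (hc 0).of_isClosed_subset (isClosed_iInter fun k => (hc k).isClosed)
    (Set.iInter_subset _ 0), ENNReal.tendsto_nhds_zero.2 fun ε hε => ?_⟩
  have hopen : IsOpen {x | Metric.infEDist x (⋂ k, X k) < ε} :=
    isOpen_lt Metric.continuous_infEDist continuous_const
  obtain ⟨K, hK⟩ := exists_subset_nhds_of_isCompact (directed_of_isDirected_le hX)
    hc (U := {x | Metric.infEDist x (⋂ k, X k) < ε})
    fun x hx => hopen.mem_nhds (by simpa [Metric.infEDist_zero_of_mem hx] using hε)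
  filter_upwards [eventually_ge_atTop K] with k hk
  refine Metric.hausdorffEDist_le_of_infEDist (fun x hx => (hK (hX hk hx)).le) fun x hx => ?_
  rw [Metric.infEDist_zero_of_mem (Set.iInter_subset X k hx)]
  exact zero_le

theorem hausdorffConverges_of_monotone {ι : Type} [Fintype ι] {X : ℕ → Set (Vec ι)}
    (hX : Monotone X) (hne : (X 0).Nonempty) (hb : IsCompact (closure (⋃ k, X k))) :
    HausdorffConverges X (closure (⋃ k, X k)) := by
  refine ⟨(hne.mono (Set.subset_iUnion X 0)).closure, hb, ENNReal.tendsto_nhds_zero.2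
    fun ε hε => ?_⟩
  obtain ⟨K, hK⟩ := hb.elim_directed_cover (fun k => {x | Metric.infEDist x (X k) < ε})
    (fun k => isOpen_lt Metric.continuous_infEDist continuous_const)
    (fun x hx => by
      obtain ⟨y, hy, hxy⟩ := EMetric.mem_closure_iff.1 hx ε hε
      obtain ⟨k, hk⟩ := Set.mem_iUnion.1 hy
      exact Set.mem_iUnion.2 ⟨k, (Metric.infEDist_le_edist_of_mem hk).trans_lt hxy⟩)
    (directed_of_isDirected_le fun i j hij x hx => (Metric.infEDist_anti (hX hij)).trans_lt hx)
  filter_upwards [eventually_ge_atTop K] with k hk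
  refine Metric.hausdorffEDist_le_of_infEDist (fun x hx => ?_) fun x hx =>
    ((Metric.infEDist_anti (hX hk)).trans_lt (hK hx)).le
  rw [Metric.infEDist_zero_of_mem (subset_closure (Set.mem_iUnion.2 ⟨k, hx⟩))]
  exact zero_le

/-- For `x ∈ L`, the distance from `x` to `M` is at most `d(X k, L) + d(Y k, M)`, which tends to 0.
-/
theorem HausdorffConverges.subset {ι : Type} [Fintype ι] {X Y : ℕ → Set (Vec ι)}
    {L M : Set (Vec ι)} (hX : HausdorffConverges X L) (hY : HausdorffConverges Y M)
    (h : ∀ k, X k ⊆ Y k) : L ⊆ M := by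
  intro x hx
  rw [Metric.mem_iff_infEDist_zero_of_closed hY.2.1.isClosed]
  have hlim := hX.2.2.add hY.2.2
  rw [add_zero] at hlim
  refine le_antisymm (ge_of_tendsto' hlim fun k => ?_) zero_le
  refine (Metric.infEDist_le_infEDist_add_hausdorffEDist (s := Y k)).trans
    (add_le_add ((Metric.infEDist_anti (h k)).trans ?_) le_rfl)
  rw [Metric.hausdorffEDist_comm]
  exact Metric.infEDist_le_hausdorffEDist_of_mem hx

/-! ### The set-dynamics -/

section Dynamics
variable {n m : ℕ} {A : Matrix (Fin n) (Fin n) ℝ} {B : Matrix (Fin n) (Fin m) ℝ}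
  {C : Set (Vec (Fin n ⊕ Fin m))}

theorem setStep_anti {P P' : Set (Vec (Fin n))} (h : polarSet P' ⊆ polarSet P) :
    setStep A B C P ⊆ setStep A B C P' :=
  Set.image_mono (polarSet_anti (Set.add_subset_add_left (Set.image_mono h)))

theorem polar_subset (hC : IsProperCSet C) (P : Set (Vec (Fin n))) :
    polarSet (polarSet C + matImage (Matrix.fromCols A B).transpose (polarSet P)) ⊆ C := by
  conv_rhs => rw [← polarSet_polarSet hC.1.1.isClosed hC.1.2.1 hC.1.2.2]
  refine polarSet_anti fun c hc => ⟨c, hc, 0, ⟨0, zero_mem_polarSet P, map_zero _⟩, add_zero c⟩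

theorem setStep_subset (hC : IsProperCSet C) (P : Set (Vec (Fin n))) :
    setStep A B C P ⊆ matImage (projX n m) C :=
  Set.image_mono (polar_subset hC P)

theorem isProperCSet_setStep (hC : IsProperCSet C) {P : Set (Vec (Fin n))}
    (hP : IsCSet (polarSet P)) : IsProperCSet (setStep A B C P) := by
  have hS : IsCSet (polarSet (polarSet C +
      matImage (Matrix.fromCols A B).transpose (polarSet P))) :=
    ⟨hC.1.1.of_isClosed_subset (isClosed_polarSet _) (polar_subset hC P), convex_polarSet _,
      zero_mem_polarSet _⟩
  refine ⟨hS.matImage _, ?_⟩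
  have h0 := zero_mem_interior_polarSet
    ((isCSet_polarSet hC.2).add (hP.matImage (Matrix.fromCols A B).transpose)).1
  -- `P_x` is surjective with right inverse `P_xᵀ`, hence open.
  have hopen : IsOpenMap (Matrix.toEuclideanLin (projX n m)) := by
    refine LinearMap.isOpenMap_of_finiteDimensional _ fun x =>
      ⟨Matrix.toEuclideanLin (projX n m).transpose x, ?_⟩
    rw [← LinearMap.comp_apply, ← Matrix.toLpLin_mul]
    simp [projX, Matrix.transpose_fromCols, Matrix.fromCols_mul_fromRows]
  exact hopen.image_interior_subset _ ⟨0, h0, map_zero _⟩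

/-- The dual form of the set-dynamics. -/
theorem exists_of_mem_polarSet_setStep (hC : IsProperCSet C) {P : Set (Vec (Fin n))}
    (hP : IsCSet (polarSet P)) {q : Vec (Fin n)} (hq : q ∈ polarSet (setStep A B C P)) :
    ∃ c ∈ polarSet C, ∃ p ∈ polarSet P,
      q = Matrix.toEuclideanLin (projX n m) c + Matrix.toEuclideanLin A.transpose p ∧
      Matrix.toEuclideanLin B.transpose p =
        -Matrix.toEuclideanLin (Matrix.fromCols 0 1 : Matrix (Fin m) (Fin n ⊕ Fin m) ℝ) c := by
  have hsum := (isCSet_polarSet hC.2).add (hP.matImage (Matrix.fromCols A B).transpose)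
  rw [setStep, polarSet_matImage, Set.mem_ofPred_eq,
    polarSet_polarSet hsum.1.isClosed hsum.2.1 hsum.2.2] at hq
  obtain ⟨c, hc, _, ⟨p, hp, rfl⟩, heq⟩ := hq
  refine ⟨c, hc, p, hp, ?_, ?_⟩
  -- Here `c + (A B)ᵀ p = P_xᵀ q = (q, 0)`; its two blocks give the two equations.
  · have h := congrArg (Matrix.toEuclideanLin (projX n m)) heq
    simp only [map_add, ← LinearMap.comp_apply, ← Matrix.toLpLin_mul] at h
    simpa [projX, Matrix.transpose_fromCols, Matrix.fromCols_mul_fromRows] using h.symm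
  · have h := congrArg (Matrix.toEuclideanLin
      (Matrix.fromCols 0 1 : Matrix (Fin m) (Fin n ⊕ Fin m) ℝ)) heq
    simp only [map_add, ← LinearMap.comp_apply, ← Matrix.toLpLin_mul] at h
    rw [eq_neg_iff_add_eq_zero, add_comm]
    simpa [projX, Matrix.transpose_fromCols, Matrix.fromCols_mul_fromRows] using h

theorem isCSet_polarSet_generatorSet (hC : IsProperCSet C) {P₀ : Set (Vec (Fin n))}
    (hP : IsCSet (polarSet P₀)) (k : ℕ) : IsCSet (polarSet (generatorSet A B C P₀ k)) := by
  induction k with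
  | zero => exact hP
  | succ k ih => exact isCSet_polarSet (isProperCSet_setStep hC ih).2

theorem isProperCSet_generatorSet (hC : IsProperCSet C) {P₀ : Set (Vec (Fin n))}
    (hP : IsCSet (polarSet P₀)) (k : ℕ) : IsProperCSet (generatorSet A B C P₀ (k + 1)) :=
  isProperCSet_setStep hC (isCSet_polarSet_generatorSet hC hP k)

/-- The index starts at 1 because the hypothesis compares polars only: `P₀` need not be closed or
convex. -/
theorem generatorSet_mono_of_le {P₀ : Set (Vec (Fin n))}
    (h : polarSet (generatorSet A B C P₀ 1) ⊆ polarSet P₀) :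
    Monotone fun k => generatorSet A B C P₀ (k + 1) := by
  refine monotone_nat_of_le_succ fun k => ?_
  induction k with
  | zero => exact setStep_anti h
  | succ k ih => exact setStep_anti (polarSet_anti ih)

theorem generatorSet_anti_of_le {P₀ : Set (Vec (Fin n))}
    (h : polarSet P₀ ⊆ polarSet (generatorSet A B C P₀ 1)) :
    Antitone fun k => generatorSet A B C P₀ (k + 1) := by
  refine antitone_nat_of_succ_le fun k => ?_
  induction k with
  | zero => exact setStep_anti h
  | succ k ih => exact setStep_anti (polarSet_anti ih)

theorem generatorSet_subset {P₀ P₀' : Set (Vec (Fin n))} (h : polarSet P₀' ⊆ polarSet P₀)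
    (k : ℕ) : generatorSet A B C P₀ (k + 1) ⊆ generatorSet A B C P₀' (k + 1) := by
  induction k with
  | zero => exact setStep_anti h
  | succ k ih => exact setStep_anti (polarSet_anti ih)

theorem exists_backwardTrajectory (hC : IsProperCSet C) :
    ∃ r : ℝ, ∀ P₀ : Set (Vec (Fin n)), IsCSet (polarSet P₀) → ∀ k N,
      ∀ q ∈ polarSet (generatorSet A B C P₀ (k + N)), ∃ p : ℕ → Vec (Fin n), p 0 = q ∧
        p N ∈ polarSet (generatorSet A B C P₀ k) ∧
        IsBackwardTrajectory (Matrix.toEuclideanLin A.transpose)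
          (Matrix.toEuclideanLin B.transpose) r N p := by
  obtain ⟨a, ha0, ha⟩ := exists_norm_le (Matrix.toEuclideanLin (projX n m))
  obtain ⟨b, hb0, hb⟩ := exists_norm_le
    (Matrix.toEuclideanLin (Matrix.fromCols 0 1 : Matrix (Fin m) (Fin n ⊕ Fin m) ℝ))
  obtain ⟨s, hs, hCs⟩ := (isCSet_polarSet hC.2).1.isBounded.exists_pos_norm_le
  refine ⟨max (a * s) (b * s), fun P₀ hP k N => ?_⟩
  induction N with
  | zero => exact fun q hq => ⟨fun _ => q, rfl, hq, fun i hi => absurd hi (Nat.not_lt_zero i)⟩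
  | succ N ih =>
    intro q hq
    obtain ⟨c, hc, p₁, hp₁, hq₁, hB⟩ := exists_of_mem_polarSet_setStep hC
      (isCSet_polarSet_generatorSet hC hP (k + N)) hq
    obtain ⟨p, hp0, hpN, hp⟩ := ih p₁ hp₁
    refine ⟨fun i => i.casesOn q p, rfl, hpN, fun i hi => ?_⟩
    cases i with
    | zero =>
      refine ⟨?_, ?_⟩
      · change ‖q - Matrix.toEuclideanLin A.transpose (p 0)‖ ≤ _
        rw [hp0, hq₁, add_sub_cancel_right]
        exact ((ha c).trans (mul_le_mul_of_nonneg_left (hCs c hc) ha0)).trans (le_max_left _ _)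
      · change ‖Matrix.toEuclideanLin B.transpose (p 0)‖ ≤ _
        rw [hp0, hB, norm_neg]
        exact ((hb c).trans (mul_le_mul_of_nonneg_left (hCs c hc) hb0)).trans (le_max_right _ _)
    | succ i => exact hp i (by omega)

/-- For a strictly stabilizable pair the polar sets of non-increasing iterates are uniformly
bounded. -/
theorem exists_bound_polarSet_generatorSet (hAB : IsStrictlyStabilizable A B)
    (hC : IsProperCSet C) {P₀ : Set (Vec (Fin n))} (hP : IsCSet (polarSet P₀))
    (hanti : Antitone fun k => generatorSet A B C P₀ (k + 1)) :
    ∃ r > 0, ∀ k, ∀ q ∈ polarSet (generatorSet A B C P₀ (k + 1)), ‖q‖ ≤ r := by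
  obtain ⟨s, hs⟩ := exists_backwardTrajectory (A := A) (B := B) hC
  have hcontr := eventually_adjoint_pow_le (Matrix.toEuclideanLin A) (controllableSubspace A B)
    (controllableSubspace_le_comap A B) hAB
  rw [← toEuclideanLin_transpose] at hcontr
  have hR : controllableSubspace A B = ⨆ j : ℕ, LinearMap.range
      ((Matrix.toEuclideanLin B.transpose ∘ₗ
        Matrix.toEuclideanLin A.transpose ^ j).adjoint) := by
    refine iSup_congr fun j => ?_
    rw [← Matrix.toLpLin_pow, ← Matrix.toLpLin_mul, ← toEuclideanLin_transpose]
    simp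
  obtain ⟨K, N, hK⟩ := IsBackwardTrajectory.exists_contraction _ _ s _ hR hcontr
  refine ⟨max (2 * K) 1, lt_max_of_lt_right one_pos, fun k q hq => le_max_of_le_left ?_⟩
  -- Polars grow with the index, so `q'` also lies in the polar `N` steps later; its trajectory ends
  -- in the original polar, where `q'` has maximal norm.
  obtain ⟨q', hq', hmax⟩ := (isCSet_polarSet_generatorSet (A := A) (B := B) hC hP
    (k + 1)).1.exists_isMaxOn ⟨q, hq⟩ continuous_norm.continuousOn
  obtain ⟨p, hp0, hpN, hp⟩ := hs P₀ hP (k + 1) N q' (by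
    rw [show k + 1 + N = k + N + 1 by omega]
    exact polarSet_anti (hanti (Nat.le_add_right k N)) hq')
  have h1 := hK p hp
  have h2 : ‖p N‖ ≤ ‖q'‖ := hmax hpN
  have h3 : ‖q‖ ≤ ‖q'‖ := hmax hq
  rw [hp0] at h1
  linarith

theorem exists_hausdorffConverges (hAB : IsStrictlyStabilizable A B) (hC : IsProperCSet C)
    {P₀ : Set (Vec (Fin n))} (hP : IsCSet (polarSet P₀))
    (h : polarSet P₀ ⊆ polarSet (generatorSet A B C P₀ 1) ∨
      polarSet (generatorSet A B C P₀ 1) ⊆ polarSet P₀) :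
    ∃ P, IsProperCSet P ∧ HausdorffConverges (fun k => generatorSet A B C P₀ (k + 1)) P := by
  have hprop := isProperCSet_generatorSet (A := A) (B := B) hC hP
  rcases h with h | h
  · have hanti := generatorSet_anti_of_le h
    have hconv := hausdorffConverges_of_antitone hanti (fun k => (hprop k).1.1)
      ⟨0, Set.mem_iInter.2 fun k => (hprop k).1.2.2⟩
    refine ⟨_, ⟨⟨hconv.2.1, convex_iInter fun k => (hprop k).1.2.1,
      Set.mem_iInter.2 fun k => (hprop k).1.2.2⟩, ?_⟩, hconv⟩
    -- Polars inside the ball of radius `r` put the ball of radius `r⁻¹` inside every iterate.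
    obtain ⟨r, hr, hbd⟩ := exists_bound_polarSet_generatorSet hAB hC hP hanti
    refine mem_interior_iff_mem_nhds.2 (mem_of_superset
      (Metric.closedBall_mem_nhds 0 (inv_pos.2 hr)) (Set.subset_iInter fun k => ?_))
    rw [← polarSet_polarSet (hprop k).1.1.isClosed (hprop k).1.2.1 (hprop k).1.2.2]
    exact closedBall_subset_polarSet hr (hbd k)
  · have hmono := generatorSet_mono_of_le h
    have hcomp : IsCompact (closure (⋃ k, generatorSet A B C P₀ (k + 1))) :=
      (hC.1.matImage (projX n m)).1.closure_of_subset
        (Set.iUnion_subset fun k => setStep_subset hC _)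
    refine ⟨_, ⟨⟨hcomp, ?_, ?_⟩, ?_⟩,
      hausdorffConverges_of_monotone hmono ⟨0, (hprop 0).1.2.2⟩ hcomp⟩
    · exact ((directed_of_isDirected_le hmono).convex_iUnion fun k => (hprop k).1.2.1).closure
    · exact subset_closure (Set.mem_iUnion.2 ⟨0, (hprop 0).1.2.2⟩)
    · exact interior_mono ((Set.subset_iUnion (fun k => generatorSet A B C P₀ (k + 1)) 0).trans
        subset_closure) (hprop 0).2

end Dynamics

end MinkowskiBellman

end

theorem theorem4p2 {n m : ℕ}
    (A : Matrix (Fin n) (Fin n) ℝ) (B : Matrix (Fin n) (Fin m) ℝ)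
    (C : Set (MinkowskiBellman.Vec (Fin n ⊕ Fin m)))
    (hAB : MinkowskiBellman.IsStrictlyStabilizable A B)
    (hC : MinkowskiBellman.IsProperCSet C)
    (P₀' P₀'' : Set (MinkowskiBellman.Vec (Fin n)))
    (hP' : MinkowskiBellman.IsCSet (MinkowskiBellman.polarSet P₀'))
    (hP'' : MinkowskiBellman.IsCSet (MinkowskiBellman.polarSet P₀''))
    (hI : MinkowskiBellman.polarSet P₀'' ⊆ MinkowskiBellman.polarSet P₀')
    (hII :
      MinkowskiBellman.polarSet P₀' ⊆
          MinkowskiBellman.polarSet (MinkowskiBellman.generatorSet A B C P₀' 1) ∨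
        MinkowskiBellman.polarSet (MinkowskiBellman.generatorSet A B C P₀' 1) ⊆
          MinkowskiBellman.polarSet P₀')
    (hIII :
      MinkowskiBellman.polarSet P₀'' ⊆
          MinkowskiBellman.polarSet (MinkowskiBellman.generatorSet A B C P₀'' 1) ∨
        MinkowskiBellman.polarSet (MinkowskiBellman.generatorSet A B C P₀'' 1) ⊆
          MinkowskiBellman.polarSet P₀'') :
    -- the limits exist and are proper `C`-sets
    (∃ P' : Set (MinkowskiBellman.Vec (Fin n)), MinkowskiBellman.IsProperCSet P' ∧
      MinkowskiBellman.HausdorffConverges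
        (fun k => MinkowskiBellman.generatorSet A B C P₀' (k + 1)) P') ∧
    (∃ P'' : Set (MinkowskiBellman.Vec (Fin n)), MinkowskiBellman.IsProperCSet P'' ∧
      MinkowskiBellman.HausdorffConverges
        (fun k => MinkowskiBellman.generatorSet A B C P₀'' (k + 1)) P'') ∧
    -- and they are ordered
    ∀ P' P'' : Set (MinkowskiBellman.Vec (Fin n)),
      MinkowskiBellman.HausdorffConverges
        (fun k => MinkowskiBellman.generatorSet A B C P₀' (k + 1)) P' →
      MinkowskiBellman.HausdorffConverges
        (fun k => MinkowskiBellman.generatorSet A B C P₀'' (k + 1)) P'' →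
      P' ⊆ P'' :=
  ⟨MinkowskiBellman.exists_hausdorffConverges hAB hC hP' hII,
    MinkowskiBellman.exists_hausdorffConverges hAB hC hP'' hIII,
    fun _ _ h' h'' => h'.subset h'' (MinkowskiBellman.generatorSet_subset hI)⟩
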